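/- Let $1\le k\le n$, and let $\mathcal W_{n,k}$ be the set of Fubini words, i.e. surjective maps $w:[n]\to[k]$, written $w=w_1\cdots w_n$. For $w\in\mathcal W_{n,k}$ let $\alpha_a(w)$ be the position of the first letter $a$ in $w$. The positions $\alpha_1(w),\dots,\alpha_k(w)$ are called initial and the others redundant. Let $\pi(w)=\pi_1\cdots\pi_k$ be the word formed by the letters of $w$ in the initial positions, read from left to right. Put $\beta_i(w)=\{j\in[n] : w_j\in\{\pi_1,\dots,\pi_i\}\}$ for $i\in[k]$. Let $P_w$ be the set of all complex $k\times n$ matrices with entry $1$ in each position $(w_j,j)$, arbitrary entries in the positions $(a,j)$ with $a\ne w_j$, $\alpha_a(w)<\alpha_{w_j}(w)$ and (either $j$ is initial and $a<w_j$, or $j$ is redundant), and entry $0$ elsewhere. Let $U$ be the group of lower unitriangular complex $k\times k$ matrices, and $C_w=UP_w$. The medium roast Fubini-Bruhat order on $\mathcal W_{n,k}$ is defined by: $v\le w$ if and only if every minor $\Delta_{I,J}$ ($I\subseteq[k]$, $J\subseteq[n]$, $|I|=|J|$) that vanishes at all matrices of $C_v$ also vanishes at all matrices of $C_w$. Let $\mathrm{conv}(w)$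 be the word $\pi_1^{m_1}\cdots\pi_k^{m_k}$, where $m_i$ is the number of occurrences of $\pi_i$ in $w$. For a Fubini word $u\in\mathcal W_{n,k}$ let $\mathrm{std}(u)\in S_n$ be obtained from $u$ by replacing the letters in the redundant positions by $k+1,\dots,n$ from left to right. For $\sigma\in S_n$ let $D(\sigma)=\{(\sigma_j,i) : i<j,\ \sigma_i>\sigma_j\}$, and let $Ess(\sigma)$ be the set of $(p,q)\in D(\sigma)$ such that $(p+1,q)\notin D(\sigma)$ and $(p,q+1)\notin D(\sigma)$. Let $r_w(h,i)$ be the maximum, over all $A\in C_w$, of the rank of the submatrix of $A$ in rows $1,\dots,h$ and columns $\beta_i(w)$. The ranked essential set of $w$ is $$Ess^*(w)=\{(h,\beta_i(w),r) : (h,|\beta_i(w)|)\in Ess(\mathrm{std}(\mathrm{conv}(w))),\ r=r_w(h,i)\}.$$ Corollary. Let $v,w\in\mathcal W_{n,k}$. Then $v\le w$ in the medium roast Fubini-Bruhat order if and only if for every $(m,\beta_j(v),s)\in Ess^*(v)$ there exists $(h,\beta_i(w),r)\in Ess^*(w)$ such that $$\max(0,m-h)+|\beta_j(v)\setminus\beta_i(w)|\le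 s-r.$$ -/

import Mathlib

/-- Fubini words of length `n` on the alphabet `[k]`: surjective maps `[n] → [k]`.
Positions and letters are indexed from `0`, so the letter `a : Fin k` stands for `a + 1 ∈ [k]`. -/
abbrev FubiniWord (n k : ℕ) : Type := {w : Fin n → Fin k // Function.Surjective w}

namespace FubiniWord

variable {n k : ℕ}

/-- `α_a(w)`: the position of the first occurrence of the letter `a` in `w`. -/
def alpha (w : FubiniWord n k) (a : Fin k) : Fin n :=
  (Finset.univ.filter fun j => w.1 j = a).min' (by
    obtain ⟨j, hj⟩ := w.2 a
    exact ⟨j, by simp [hj]⟩)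

theorem apply_alpha (w : FubiniWord n k) (a : Fin k) : w.1 (w.alpha a) = a := by
  have h := Finset.min'_mem (Finset.univ.filter fun j => w.1 j = a) (by
    obtain ⟨j, hj⟩ := w.2 a
    exact ⟨j, by simp [hj]⟩)
  exact (Finset.mem_filter.1 h).2

theorem alpha_injective (w : FubiniWord n k) : Function.Injective w.alpha := fun a b h => by
  rw [← w.apply_alpha a, h, w.apply_alpha b]

/-- The initial positions `in(w) = {α_1, …, α_k}`; the other positions are redundant. -/
def initialPositions (w : FubiniWord n k) : Finset (Fin n) := Finset.univ.image w.alpha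

theorem card_initialPositions (w : FubiniWord n k) : w.initialPositions.card = k := by
  rw [initialPositions, Finset.card_image_of_injective _ w.alpha_injective]
  simp

/-- The initial permutation `π(w)` in one-line notation: `initialPerm w i` is the letter in the
`i`-th initial position from the left. -/
def initialPerm (w : FubiniWord n k) (i : Fin k) : Fin k :=
  w.1 (w.initialPositions.orderEmbOfFin w.card_initialPositions i)

theorem eq_initialPerm (w : FubiniWord n k) (g : Fin k → Fin k)
    (hg : StrictMono fun i => w.alpha (g i)) : g = w.initialPerm := by
  have h := Finset.orderEmbOfFin_unique w.card_initialPositions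
    (f := fun i => w.alpha (g i)) (fun i => by simp [initialPositions]) hg
  funext i
  rw [initialPerm, ← h, w.apply_alpha]

theorem alpha_initialPerm (w : FubiniWord n k) (i : Fin k) :
    w.alpha (w.initialPerm i) =
      w.initialPositions.orderEmbOfFin w.card_initialPositions i := by
  have h := Finset.orderEmbOfFin_mem w.initialPositions w.card_initialPositions i
  obtain ⟨a, -, ha⟩ := Finset.mem_image.1 h
  rw [initialPerm, ← ha, w.apply_alpha]

/-- `β_i(w)`: the set of positions of the letters `π_1, …, π_i` in `w`. -/
def beta (w : FubiniWord n k) (i : Fin k) : Finset (Fin n) :=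
  Finset.univ.filter fun j => ∃ l ≤ i, w.1 j = w.initialPerm l

/-- A word is convex if the occurrences of each letter are contiguous. -/
def IsConvex (w : FubiniWord n k) : Prop :=
  ∀ h i j : Fin n, h < i → i < j → w.1 h = w.1 j → w.1 i = w.1 j

/-- The convexification of `w`: the letters of `w`, sorted by the position of
their first occurrence in `w`. The three theorems below show that this is a convex word with the
same content and the same initial permutation as `w`. -/
def conv (w : FubiniWord n k) : FubiniWord n k :=
  ⟨fun j => w.1 (Tuple.sort (fun i => w.alpha (w.1 i)) j), fun a => by
    obtain ⟨j, hj⟩ := w.2 a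
    exact ⟨(Tuple.sort fun i => w.alpha (w.1 i)).symm j, by simp [hj]⟩⟩

theorem alpha_conv_monotone (w : FubiniWord n k) : Monotone fun j => w.alpha (w.conv.1 j) :=
  Tuple.monotone_sort fun i => w.alpha (w.1 i)

theorem conv_isConvex (w : FubiniWord n k) : w.conv.IsConvex := fun h i j hhi hij e => by
  have h1 := w.alpha_conv_monotone hhi.le
  have h2 := w.alpha_conv_monotone hij.le
  simp only [e] at h1
  exact w.alpha_injective (le_antisymm h2 h1)

theorem conv_content (w : FubiniWord n k) (a : Fin k) :
    (Finset.univ.filter fun j => w.conv.1 j = a).card =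
      (Finset.univ.filter fun j => w.1 j = a).card :=
  Finset.card_equiv (Tuple.sort fun i => w.alpha (w.1 i)) (fun j => by
    rw [Finset.mem_filter_univ, Finset.mem_filter_univ]
    rfl)

theorem conv_initialPerm (w : FubiniWord n k) : w.conv.initialPerm = w.initialPerm := by
  refine (w.conv.eq_initialPerm _ fun i j hij => ?_).symm
  by_contra hc
  have h := w.alpha_conv_monotone (not_lt.1 hc)
  simp only [apply_alpha, alpha_initialPerm] at h
  exact absurd hij (not_lt.2 ((OrderEmbedding.le_iff_le _).1 h))

theorem card_redundant (w : FubiniWord n k) : (w.initialPositionsᶜ).card + k = n := by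
  have h := Finset.card_compl_add_card w.initialPositions
  rwa [w.card_initialPositions, Fintype.card_fin] at h

/-- The number of redundant positions of `w` to the left of position `j`. -/
def redundantBefore (w : FubiniWord n k) (j : Fin n) : ℕ :=
  (w.initialPositionsᶜ.filter fun i => i < j).card

theorem redundantBefore_lt (w : FubiniWord n k) {i j : Fin n} (hi : i ∉ w.initialPositions)
    (hij : i < j) : w.redundantBefore i < w.redundantBefore j := by
  refine Finset.card_lt_card (Finset.ssubset_iff_of_subset ?_ |>.2 ⟨i, ?_, ?_⟩)
  · intro l hl
    rw [Finset.mem_filter] at hl ⊢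
    exact ⟨hl.1, hl.2.trans hij⟩
  · simp [hi, hij]
  · simp

theorem add_redundantBefore_lt (w : FubiniWord n k) {j : Fin n} (hj : j ∉ w.initialPositions) :
    k + w.redundantBefore j < n := by
  have h : w.redundantBefore j < (w.initialPositionsᶜ).card := by
    refine Finset.card_lt_card (Finset.ssubset_iff_of_subset (Finset.filter_subset _ _) |>.2
      ⟨j, ?_, ?_⟩)
    · simp [hj]
    · simp
  have := w.card_redundant
  omega

/-- The values of the standardization: initial letters are kept and the redundant letters are
replaced, from left to right, by `k + 1, …, n` (here `k, …, n - 1`, counting from `0`). -/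
def stdFun (w : FubiniWord n k) (j : Fin n) : Fin n :=
  if h : j ∈ w.initialPositions then
    ⟨w.1 j, (w.1 j).2.trans_le (by have := w.card_redundant; omega)⟩
  else ⟨k + w.redundantBefore j, w.add_redundantBefore_lt h⟩

theorem stdFun_injective (w : FubiniWord n k) : Function.Injective w.stdFun := by
  intro i j hij
  by_cases hi : i ∈ w.initialPositions <;> by_cases hj : j ∈ w.initialPositions <;>
    simp only [stdFun, hi, hj, dif_pos, dif_neg, not_false_eq_true, Fin.mk.injEq] at hij
  · obtain ⟨a, -, rfl⟩ := Finset.mem_image.1 hi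
    obtain ⟨b, -, rfl⟩ := Finset.mem_image.1 hj
    rw [apply_alpha, apply_alpha] at hij
    rw [Fin.ext hij]
  · have := (w.1 i).2
    omega
  · have := (w.1 j).2
    omega
  · rcases lt_trichotomy i j with h | h | h
    · have := w.redundantBefore_lt hi h
      omega
    · exact h
    · have := w.redundantBefore_lt hj h
      omega

/-- The standardization `std(w) ∈ S_n`. -/
noncomputable def std (w : FubiniWord n k) : Equiv.Perm (Fin n) :=
  Equiv.ofBijective w.stdFun (Finite.injective_iff_bijective.1 w.stdFun_injective)

/-- The `k × n` complex matrices fitting the pattern of `w`: there is a `1` in each position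
`(w_j, j)`; a position `(a, j)` with `a ≠ w_j` is free (a `⋆` of the pattern) when
`α_a < α_{w_j}` and either `j` is initial and `a < w_j`, or `j` is redundant; all the other
entries are `0`. -/
def FitsPattern (w : FubiniWord n k) (A : Matrix (Fin k) (Fin n) ℂ) : Prop :=
  (∀ j, A (w.1 j) j = 1) ∧
    ∀ a j, a ≠ w.1 j →
      ¬ (w.alpha a < w.alpha (w.1 j) ∧ (j ∈ w.initialPositions → a < w.1 j)) → A a j = 0

/-- Lower unitriangular matrices. -/
def IsLowerUnitriangular (X : Matrix (Fin k) (Fin k) ℂ) : Prop :=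
  (∀ a, X a a = 1) ∧ ∀ a b, a < b → X a b = 0

/-- The cell `C_w = U P_w`, given by its matrix representatives `X Y`, where `X` is lower
unitriangular and `Y` fits the pattern of `w`. -/
def cell (w : FubiniWord n k) : Set (Matrix (Fin k) (Fin n) ℂ) :=
  {A | ∃ (X : Matrix (Fin k) (Fin k) ℂ) (Y : Matrix (Fin k) (Fin n) ℂ),
    IsLowerUnitriangular X ∧ w.FitsPattern Y ∧ A = X * Y}

/-- The minor `Δ_{I,J}(A)`, for row and column sets of the same size. -/
noncomputable def minor (A : Matrix (Fin k) (Fin n) ℂ) (I : Finset (Fin k)) (J : Finset (Fin n))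
    (h : I.card = J.card) : ℂ :=
  (A.submatrix (I.orderEmbOfFin h) (J.orderEmbOfFin rfl)).det

/-- The index pairs `(I, J)` of the minors that vanish on the whole cell `C_w`. -/
def vanishingMinors (w : FubiniWord n k) : Set (Finset (Fin k) × Finset (Fin n)) :=
  {p | ∃ h : p.1.card = p.2.card, ∀ A ∈ w.cell, minor A p.1 p.2 h = 0}

/-- The medium roast Fubini-Bruhat order: every minor that vanishes on `C_v` vanishes on `C_w`. -/
def MediumRoastLE (v w : FubiniWord n k) : Prop := v.vanishingMinors ⊆ w.vanishingMinors

/-- The rank of `A[[h], J]`, the submatrix of `A` in the top `h` rows and the columns in `J`. -/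
noncomputable def topRank (A : Matrix (Fin k) (Fin n) ℂ) (h : ℕ) (J : Finset (Fin n)) : ℕ :=
  (A.submatrix (fun a : {a : Fin k // (a : ℕ) < h} => a.1) (fun j : {j // j ∈ J} => j.1)).rank

theorem topRank_le (A : Matrix (Fin k) (Fin n) ℂ) (h : ℕ) (J : Finset (Fin n)) :
    topRank A h J ≤ n :=
  (Matrix.rank_le_card_width _).trans (by
    simpa using Finset.card_le_univ J)

/-- The rank function `r_w(h, i)`: the maximum of the rank of `A[[h], β_i]` over all `A ∈ C_w`
(a maximum over a non-empty bounded set, see `rankFun_isGreatest`). -/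
noncomputable def rankFun (w : FubiniWord n k) (h : ℕ) (i : Fin k) : ℕ :=
  sSup {r | ∃ A ∈ w.cell, r = topRank A h (w.beta i)}

theorem cell_nonempty (w : FubiniWord n k) : w.cell.Nonempty :=
  ⟨_, 1, fun a j => if a = w.1 j then 1 else 0,
    ⟨fun a => by simp, fun a b h => by simp [h.ne]⟩,
    ⟨fun j => by simp, fun a j h _ => by simp [h]⟩, rfl⟩

theorem rankFun_isGreatest (w : FubiniWord n k) (h : ℕ) (i : Fin k) :
    IsGreatest {r | ∃ A ∈ w.cell, r = topRank A h (w.beta i)} (w.rankFun h i) := by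
  have hb : BddAbove {r | ∃ A ∈ w.cell, r = topRank A h (w.beta i)} :=
    ⟨n, by rintro _ ⟨A, -, rfl⟩; exact topRank_le A h _⟩
  obtain ⟨A, hA⟩ := w.cell_nonempty
  exact ⟨Nat.sSup_mem ⟨_, A, hA, rfl⟩ hb, fun r hr => le_csSup hb hr⟩

end FubiniWord

/-- The Rothe diagram `{(σ_j, i) | i < j, σ_i > σ_j}` of `σ ∈ S_n`, in matrix coordinates counted
from `1`. -/
def rotheDiagram {n : ℕ} (σ : Equiv.Perm (Fin n)) : Set (ℕ × ℕ) :=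
  {p | ∃ i j : Fin n, i < j ∧ σ j < σ i ∧ p = ((σ j : ℕ) + 1, (i : ℕ) + 1)}

/-- Fulton's essential set `Ess(σ)`. -/
def essentialSet {n : ℕ} (σ : Equiv.Perm (Fin n)) : Set (ℕ × ℕ) :=
  {p | p ∈ rotheDiagram σ ∧ (p.1 + 1, p.2) ∉ rotheDiagram σ ∧ (p.1, p.2 + 1) ∉ rotheDiagram σ}

/-- The ranked essential set `Ess*(w)`. -/
def FubiniWord.rankedEssentialSet {n k : ℕ} (w : FubiniWord n k) :
    Set (ℕ × Finset (Fin n) × ℕ) :=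
  {t | ∃ (h : ℕ) (i : Fin k), (h, (w.beta i).card) ∈ essentialSet w.conv.std ∧
    t = (h, w.beta i, w.rankFun h i)}

/-! Write c_w(h,i) for `letterCount` and F_w(i) for `firstCols`. On C_w the rank of the top h rows
in the columns F_w(i) is at most c_w(h,i), and c_w is in fact the rank function
(`rankFun_eq_letterCount`). Columns outside F_w(i) add at most one each, so Δ_{I,J} vanishes on C_w
whenever c_w(h,i) + |J \ F_w(i)| < |I ∩ [h]| for some h, i. These are the only vanishing minors
(`mem_vanishingMinors_iff`): if no such inequality holds, a greedy matching (`exists_matching`)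
pairs rows with columns along the pattern, and suitable weights on the matched entries give a
diagonally dominant submatrix (`exists_mem_cell_det_ne_zero`).

Hence v ≤ w amounts to: for all m, j there is an i with c_w(m,i) + |F_v(j) \ F_w(i)| ≤ c_v(m,j).
Both sides of this criterion reduce to essential boxes by `exists_isEssentialBox`: a pair (h,i) can
be moved by unit steps without increasing c(h,i) + max(0,m-h) + |B \ F(i)|, until it is an essential
box or a trivial bound appears. Applied to w, this replaces the witness i by an essential box;
applied to v, it deduces all conditions from the essential ones. The triangle inequality for set
differences and c(m,i) ≤ c(h,i) + max(0,m-h) join the pieces. -/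

/-! ### Greedy matching with deadlines -/

theorem Finset.filter_sup_add_one_le {δ : Type*} (J : Finset δ) (f : δ → ℕ) :
    (J.filter fun j => J.sup f + 1 ≤ f j) = ∅ :=
  Finset.filter_eq_empty_iff.2 fun _ hj h => absurd (Finset.le_sup (f := f) hj) (by omega)

/-- A greedy matching of rows with columns whose neighbourhoods are nested, with deadlines `d` for
the rows. A column `j ∈ S` is moreover never matched with a row after `W j`. -/
theorem exists_matching {γ ρ δ : Type*} [LinearOrder ρ] [Nonempty δ]
    (idx : ρ → ℕ) (W : δ → ρ) (S : Set δ) (hS : Set.InjOn W S) (d : γ → ρ) (R : Finset ρ) :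
    ∀ (I : Finset γ) (J : Finset δ), (∀ j ∈ J, j ∈ S → W j ∈ R) →
      (∀ h i, (I.filter fun x => d x ≤ h).card ≤
        (R.filter fun a => a ≤ h ∧ idx a < i).card + (J.filter fun j => i ≤ idx (W j)).card) →
      ∃ (κ : γ → ρ) (g : γ → δ), Set.InjOn κ I ∧ Set.InjOn g I ∧
        ∀ x ∈ I, κ x ∈ R ∧ g x ∈ J ∧ κ x ≤ d x ∧ idx (κ x) ≤ idx (W (g x)) ∧
          (g x ∈ S → κ x ≤ W (g x)) := by
  classical
  induction R using Finset.induction_on_min with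
  | empty =>
    intro I J _ hc
    have hI : I = ∅ := by
      by_contra hne
      obtain ⟨x, hx⟩ := Finset.nonempty_iff_ne_empty.2 hne
      -- The level is one above every column, so the column term of the hypothesis vanishes.
      have h1 := hc (d x) (J.sup (fun j => idx (W j)) + 1)
      have h2 := J.filter_sup_add_one_le fun j => idx (W j)
      have h3 : 0 < (I.filter fun y => d y ≤ d x).card :=
        Finset.card_pos.2 ⟨x, by simp [hx]⟩
      simp only [h2, Finset.filter_empty, Finset.card_empty] at h1
      omega
    subst hI
    exact ⟨d, fun _ => Classical.arbitrary δ, by simp, by simp, by simp⟩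
  | insert r R hr ih =>
    intro I J hSR hc
    have hrR : r ∉ R := fun h => lt_irrefl _ (hr r h)
    rcases I.eq_empty_or_nonempty with rfl | hI
    · exact ⟨d, fun _ => Classical.arbitrary δ, by simp, by simp, by simp⟩
    obtain ⟨x₀, hx₀, hmin⟩ := I.exists_min_image d hI
    -- The smallest row `r` goes to the element with the earliest deadline. If it missed that
    -- deadline, so would every other row.
    have hrd : r ≤ d x₀ := by
      by_contra hlt
      have h1 := hc (d x₀) (J.sup (fun j => idx (W j)) + 1)
      have h2 := J.filter_sup_add_one_le fun j => idx (W j)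
      have h3 : 0 < (I.filter fun y => d y ≤ d x₀).card :=
        Finset.card_pos.2 ⟨x₀, by simp [hx₀]⟩
      have h4 : ((insert r R).filter fun a => a ≤ d x₀ ∧
          idx a < J.sup (fun j => idx (W j)) + 1) = ∅ := by
        refine Finset.filter_eq_empty_iff.2 fun a ha hh => ?_
        rcases Finset.mem_insert.1 ha with rfl | ha
        · exact hlt hh.1
        · exact hlt ((hr a ha).le.trans hh.1)
      rw [h2, h4] at h1
      simp only [Finset.card_empty] at h1
      omega
    have hge : ∀ i, ∀ h, idx r ≥ i → ((insert r R).filter fun a => a ≤ h ∧ idx a < i) =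
        R.filter fun a => a ≤ h ∧ idx a < i := fun i h hi => by
      rw [Finset.filter_insert, if_neg (by omega)]
    have hmono : ∀ i, ∀ h, idx r ≤ i → (R.filter fun a => a ≤ h ∧ idx a < idx r).card ≤
        (R.filter fun a => a ≤ h ∧ idx a < i).card := fun i h hi =>
      Finset.card_le_card fun a ha => by
        simp only [Finset.mem_filter] at ha ⊢
        exact ⟨ha.1, ha.2.1, by omega⟩
    by_cases hJ : ∃ j ∈ J, idx r ≤ idx (W j)
    -- `r` takes an admissible column of least level, preferring the column of `S` with `W j = r`,
    -- which no later row may use. Removing it keeps `W j ∈ R` for the remaining columns of `S`, so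
    -- the constraint `κ x ≤ W (g x)` holds automatically when the smallest row is matched.
    · obtain ⟨j₀, hj₀, hlev, hjmin, hjS⟩ : ∃ j₀ ∈ J, idx r ≤ idx (W j₀) ∧
          (∀ j ∈ J, idx r ≤ idx (W j) → idx (W j₀) ≤ idx (W j)) ∧
          (∀ j ∈ J, j ∈ S → W j = r → j = j₀) := by
        by_cases hs : ∃ j ∈ J, j ∈ S ∧ W j = r
        · obtain ⟨j, hj, hjS, rfl⟩ := hs
          exact ⟨j, hj, le_rfl, fun _ _ h => h, fun j' _ h1 h2 => hS h1 hjS h2⟩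
        · obtain ⟨j, hj, hjm⟩ := (J.filter fun j => idx r ≤ idx (W j)).exists_min_image
            (fun j => idx (W j)) (by
              obtain ⟨j, hj, hj'⟩ := hJ
              exact ⟨j, by simp [hj, hj']⟩)
          rw [Finset.mem_filter] at hj
          exact ⟨j, hj.1, hj.2, fun j' h1 h2 => hjm j' (by simp [h1, h2]),
            fun j' h1 h2 h3 => absurd ⟨j', h1, h2, h3⟩ hs⟩
      obtain ⟨κ, g, hκ, hg, hall⟩ := ih (I.erase x₀) (J.erase j₀) (fun j hj hjs => by
          rw [Finset.mem_erase] at hj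
          rcases Finset.mem_insert.1 (hSR j hj.2 hjs) with h | h
          · exact absurd (hjS j hj.2 hjs h) hj.1
          · exact h) (fun h i => by
          by_cases hh : d x₀ ≤ h
          · have e1 : ((I.erase x₀).filter fun x => d x ≤ h).card + 1 =
                (I.filter fun x => d x ≤ h).card := by
              rw [Finset.filter_erase]
              exact Finset.card_erase_add_one (by simp [hx₀, hh])
            have hrh := hrd.trans hh
            have e2 : i ≤ idx (W j₀) → ((J.erase j₀).filter fun j => i ≤ idx (W j)).card + 1 =
                (J.filter fun j => i ≤ idx (W j)).card := fun hi => by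
              rw [Finset.filter_erase]
              exact Finset.card_erase_add_one (by simp [hj₀, hi])
            rcases le_or_gt i (idx r) with h1 | h1
            · have := hc h i
              rw [hge i h h1] at this
              have := e2 (h1.trans hlev)
              omega
            · rcases le_or_gt i (idx (W j₀)) with h2 | h2
              -- Between the levels of `r` and `j₀` the hypothesis is used at level `idx r`: by
              -- minimality of `j₀`, every column counted there still counts at level `i`.
              · have h3 := hc h (idx r)
                rw [hge _ h le_rfl] at h3
                have h4 := hmono i h h1.le
                have h5 : (J.filter fun j => idx r ≤ idx (W j)).card ≤
                    (J.filter fun j => i ≤ idx (W j)).card :=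
                  Finset.card_le_card fun j hj => by
                    simp only [Finset.mem_filter] at hj ⊢
                    exact ⟨hj.1, h2.trans (hjmin j hj.1 hj.2)⟩
                have := e2 h2
                omega
              · have h3 := hc h i
                have h4 : ((insert r R).filter fun a => a ≤ h ∧ idx a < i).card ≤
                    (R.filter fun a => a ≤ h ∧ idx a < i).card + 1 := by
                  rw [Finset.filter_insert, if_pos ⟨hrh, h1⟩]
                  exact Finset.card_insert_le _ _
                have h5 : ((J.erase j₀).filter fun j => i ≤ idx (W j)) =
                    J.filter fun j => i ≤ idx (W j) := by
                  rw [Finset.filter_erase]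
                  exact Finset.erase_eq_of_notMem (by simp; omega)
                rw [h5]
                omega
          · have : ((I.erase x₀).filter fun x => d x ≤ h) = ∅ :=
              Finset.filter_eq_empty_iff.2 fun x hx hxh =>
                hh ((hmin x (Finset.mem_of_mem_erase hx)).trans hxh)
            rw [this]
            simp)
      have hne : ∀ x ∈ I, x ≠ x₀ → κ x ≠ r ∧ g x ≠ j₀ := fun x hx hxx => by
        have := hall x (Finset.mem_erase.2 ⟨hxx, hx⟩)
        exact ⟨fun h => hrR (h ▸ this.1), (Finset.mem_erase.1 this.2.1).1⟩
      refine ⟨Function.update κ x₀ r, Function.update g x₀ j₀, ?_, ?_, ?_⟩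
      · intro x hx y hy hxy
        by_cases h1 : x = x₀ <;> by_cases h2 : y = x₀
        · rw [h1, h2]
        · subst h1
          rw [Function.update_self, Function.update_of_ne h2] at hxy
          exact absurd hxy.symm (hne y hy h2).1
        · subst h2
          rw [Function.update_self, Function.update_of_ne h1] at hxy
          exact absurd hxy (hne x hx h1).1
        · rw [Function.update_of_ne h1, Function.update_of_ne h2] at hxy
          exact hκ (by simpa [h1] using hx) (by simpa [h2] using hy) hxy
      · intro x hx y hy hxy
        by_cases h1 : x = x₀ <;> by_cases h2 : y = x₀
        · rw [h1, h2]
        · subst h1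
          rw [Function.update_self, Function.update_of_ne h2] at hxy
          exact absurd hxy.symm (hne y hy h2).2
        · subst h2
          rw [Function.update_self, Function.update_of_ne h1] at hxy
          exact absurd hxy (hne x hx h1).2
        · rw [Function.update_of_ne h1, Function.update_of_ne h2] at hxy
          exact hg (by simpa [h1] using hx) (by simpa [h2] using hy) hxy
      · intro x hx
        by_cases h1 : x = x₀
        · subst h1
          simp only [Function.update_self]
          refine ⟨Finset.mem_insert_self _ _, hj₀, hrd, hlev, fun hs => ?_⟩
          rcases Finset.mem_insert.1 (hSR j₀ hj₀ hs) with h | h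
          · exact h.ge
          · exact (hr _ h).le
        · simp only [Function.update_of_ne h1]
          obtain ⟨h2, h3, h4⟩ := hall x (Finset.mem_erase.2 ⟨h1, hx⟩)
          exact ⟨Finset.mem_insert_of_mem h2, Finset.mem_of_mem_erase h3, h4⟩
    -- No column accepts `r`, so this row is dropped. Above its level, the hypothesis at level `idx
    -- r` has no column term and already gives the bound.
    · push Not at hJ
      obtain ⟨κ, g, hκ, hg, hall⟩ := ih I J (fun j hj hjs => by
          rcases Finset.mem_insert.1 (hSR j hj hjs) with h | h
          · have := hJ j hj
            rw [h] at this
            exact absurd this (lt_irrefl _)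
          · exact h) (fun h i => by
          rcases le_or_gt i (idx r) with h1 | h1
          · have := hc h i
            rwa [hge i h h1] at this
          · have h2 := hc h (idx r)
            rw [hge _ h le_rfl] at h2
            have h3 : (J.filter fun j => idx r ≤ idx (W j)) = ∅ :=
              Finset.filter_eq_empty_iff.2 fun j hj => not_le.2 (hJ j hj)
            rw [h3, Finset.card_empty] at h2
            have := hmono i h h1.le
            omega)
      exact ⟨κ, g, hκ, hg, fun x hx => ⟨Finset.mem_insert_of_mem (hall x hx).1, (hall x hx).2⟩⟩

/-! ### Ranks of submatrices on a cell -/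

namespace FubiniWord

variable {n k : ℕ}

theorem initialPerm_injective (w : FubiniWord n k) : Function.Injective w.initialPerm :=
  fun i j h => by
    have h1 := w.alpha_initialPerm i
    rw [h, w.alpha_initialPerm j] at h1
    exact ((RelEmbedding.injective _) h1).symm

/-- The index of the letter `a` in the initial permutation, so that `π_{letterIndex a} = a`. -/
noncomputable def letterIndex (w : FubiniWord n k) : Fin k ≃ Fin k :=
  (Equiv.ofBijective w.initialPerm
    (Finite.injective_iff_bijective.1 w.initialPerm_injective)).symm

@[simp]
theorem letterIndex_initialPerm (w : FubiniWord n k) (i : Fin k) :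
    w.letterIndex (w.initialPerm i) = i :=
  Equiv.ofBijective_symm_apply_apply _ _ _

@[simp]
theorem initialPerm_letterIndex (w : FubiniWord n k) (a : Fin k) :
    w.initialPerm (w.letterIndex a) = a :=
  Equiv.ofBijective_apply_symm_apply _ _ _

theorem alpha_eq (w : FubiniWord n k) (a : Fin k) :
    w.alpha a = w.initialPositions.orderEmbOfFin w.card_initialPositions (w.letterIndex a) := by
  rw [← alpha_initialPerm, initialPerm_letterIndex]

theorem alpha_lt_alpha (w : FubiniWord n k) {a b : Fin k} :
    w.alpha a < w.alpha b ↔ w.letterIndex a < w.letterIndex b := by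
  rw [alpha_eq, alpha_eq, OrderEmbedding.lt_iff_lt]

theorem alpha_le_alpha (w : FubiniWord n k) {a b : Fin k} :
    w.alpha a ≤ w.alpha b ↔ w.letterIndex a ≤ w.letterIndex b := by
  rw [alpha_eq, alpha_eq, OrderEmbedding.le_iff_le]

theorem alpha_le (w : FubiniWord n k) (j : Fin n) : w.alpha (w.1 j) ≤ j :=
  Finset.min'_le _ _ (by simp)

theorem mem_initialPositions (w : FubiniWord n k) {j : Fin n} :
    j ∈ w.initialPositions ↔ w.alpha (w.1 j) = j := by
  constructor
  · intro h
    obtain ⟨a, -, rfl⟩ := Finset.mem_image.1 h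
    rw [apply_alpha]
  · intro h
    exact Finset.mem_image.2 ⟨_, Finset.mem_univ _, h⟩

/-- The number of letters below `h` among the first `i` letters of the initial permutation. -/
noncomputable def letterCount (w : FubiniWord n k) (h i : ℕ) : ℕ :=
  (Finset.univ.filter fun a : Fin k => (a : ℕ) < h ∧ (w.letterIndex a : ℕ) < i).card

/-- The positions of the first `i` letters of the initial permutation. -/
noncomputable def firstCols (w : FubiniWord n k) (i : ℕ) : Finset (Fin n) :=
  Finset.univ.filter fun j => (w.letterIndex (w.1 j) : ℕ) < i

@[simp]
theorem mem_firstCols (w : FubiniWord n k) {i : ℕ} {j : Fin n} :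
    j ∈ w.firstCols i ↔ (w.letterIndex (w.1 j) : ℕ) < i := by
  simp [firstCols]

theorem beta_eq (w : FubiniWord n k) (i : Fin k) : w.beta i = w.firstCols (i + 1) := by
  ext j
  simp only [beta, Finset.mem_filter, Finset.mem_univ, true_and, mem_firstCols]
  constructor
  · rintro ⟨l, hl, h⟩
    rw [h, letterIndex_initialPerm]
    exact Nat.lt_succ_of_le hl
  · intro h
    exact ⟨w.letterIndex (w.1 j), Nat.le_of_lt_succ h, (w.initialPerm_letterIndex _).symm⟩

theorem FitsPattern.eq_zero {w : FubiniWord n k} {Y : Matrix (Fin k) (Fin n) ℂ}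
    (hY : w.FitsPattern Y) {a : Fin k} {j : Fin n}
    (h : w.letterIndex (w.1 j) < w.letterIndex a) : Y a j = 0 := by
  refine hY.2 a j ?_ fun h' => lt_asymm h (w.alpha_lt_alpha.1 h'.1)
  rintro rfl
  exact lt_irrefl _ h

/-- In A = XY, the rows of X above `h` involve only letters below `h`, and the columns of Y in
`firstCols i` involve only letters of index below `i`. That block therefore factors through the
letters counted by `letterCount`; each remaining column costs one more dimension. -/
theorem rank_submatrix_le_letterCount (w : FubiniWord n k) {A : Matrix (Fin k) (Fin n) ℂ}
    (hA : A ∈ w.cell) {γ δ : Type*} [Fintype δ] (f : γ → Fin k) (g : δ → Fin n) {h : ℕ}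
    (hf : ∀ x, (f x : ℕ) < h) (i : ℕ) :
    (A.submatrix f g).rank ≤ w.letterCount h i +
      (Finset.univ.filter fun y => g y ∉ w.firstCols i).card := by
  classical
  obtain ⟨X, Y, hX, hY, rfl⟩ := hA
  let M₁ : Matrix γ {a : Fin k // (a : ℕ) < h ∧ (w.letterIndex a : ℕ) < i} ℂ :=
    fun x a => X (f x) a
  let N₁ : Matrix {a : Fin k // (a : ℕ) < h ∧ (w.letterIndex a : ℕ) < i} δ ℂ :=
    fun a y => if g y ∈ w.firstCols i then Y a (g y) else 0
  let M₂ : Matrix γ {y : δ // g y ∉ w.firstCols i} ℂ := fun x y => (X * Y) (f x) (g y)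
  let N₂ : Matrix {y : δ // g y ∉ w.firstCols i} δ ℂ := fun y' y => if y'.1 = y then 1 else 0
  have key : (X * Y).submatrix f g = Matrix.fromCols M₁ M₂ * Matrix.fromRows N₁ N₂ := by
    rw [Matrix.fromCols_mul_fromRows]
    ext x y
    simp only [Matrix.submatrix_apply, Matrix.add_apply]
    by_cases hy : g y ∈ w.firstCols i
    · have h2 : (M₂ * N₂) x y = 0 := by
        rw [Matrix.mul_apply]
        refine Finset.sum_eq_zero fun y' _ => ?_
        have : y'.1 ≠ y := fun e => y'.2 (e ▸ hy)
        simp [N₂, this]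
      rw [h2, add_zero, Matrix.mul_apply, Matrix.mul_apply]
      simp only [M₁, N₁, hy, if_true]
      refine Eq.trans (Finset.sum_subset (Finset.filter_subset (fun a : Fin k =>
        (a : ℕ) < h ∧ (w.letterIndex a : ℕ) < i) Finset.univ) ?_).symm (Finset.sum_subtype _
          (by simp) fun a => X (f x) a * Y a (g y))
      · intro a _ ha
        simp only [Finset.mem_filter, Finset.mem_univ, true_and] at ha
        rw [mem_firstCols] at hy
        by_cases hah : (a : ℕ) < h
        · rw [hY.eq_zero, mul_zero]
          exact Fin.lt_def.2 (by by_contra hc; exact ha ⟨hah, by omega⟩)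
        · rw [hX.2, zero_mul]
          exact Fin.lt_def.2 (by have := hf x; omega)
    · have h1 : (M₁ * N₁) x y = 0 := by
        rw [Matrix.mul_apply]
        exact Finset.sum_eq_zero fun a _ => by simp only [N₁, if_neg hy, mul_zero]
      rw [h1, zero_add, Matrix.mul_apply (M := M₂)]
      rw [Finset.sum_eq_single ⟨y, hy⟩]
      · simp [M₂, N₂]
      · intro y' _ hne
        have : y'.1 ≠ y := fun e => hne (Subtype.ext e)
        simp [N₂, this]
      · simp
  rw [key]
  refine (Matrix.rank_mul_le_left _ _).trans ((Matrix.rank_le_card_width _).trans ?_)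
  rw [Fintype.card_sum, Fintype.card_subtype, Fintype.card_subtype]
  rfl

theorem rankFun_eq_letterCount (w : FubiniWord n k) (h : ℕ) (i : Fin k) :
    w.rankFun h i = w.letterCount h (i + 1) := by
  classical
  have hg := w.rankFun_isGreatest h i
  refine le_antisymm ?_ ?_
  · obtain ⟨A, hA, hr⟩ := hg.1
    rw [hr, topRank]
    refine (w.rank_submatrix_le_letterCount hA _ _ (fun a => a.2) (i + 1)).trans ?_
    rw [Finset.filter_eq_empty_iff.2]
    · simp
    · rintro ⟨j, hj⟩ _
      rw [← beta_eq]
      exact not_not_intro hj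
  -- With all free entries zero, the counted letters and their initial positions span an identity
  -- block.
  · let Y : Matrix (Fin k) (Fin n) ℂ := fun a j => if a = w.1 j then 1 else 0
    have hY : Y ∈ w.cell := ⟨1, Y, ⟨fun a => by simp, fun a b h => by simp [h.ne]⟩,
      ⟨fun j => by simp [Y], fun a j h _ => by simp [Y, h]⟩, by simp⟩
    refine le_trans ?_ (hg.2 ⟨Y, hY, rfl⟩)
    let R := {a : Fin k // (a : ℕ) < h ∧ (w.letterIndex a : ℕ) < i + 1}
    let r : R → {a : Fin k // (a : ℕ) < h} := fun a => ⟨a.1, a.2.1⟩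
    let c : R → {j // j ∈ w.beta i} := fun a => ⟨w.alpha a.1, by
      rw [beta_eq, mem_firstCols, apply_alpha]
      exact a.2.2⟩
    rw [topRank]
    refine le_trans (le_of_eq ?_) (Matrix.rank_submatrix_le _ r c)
    have : (Y.submatrix (fun a : {a : Fin k // (a : ℕ) < h} => a.1)
        fun j : {j // j ∈ w.beta i} => j.1).submatrix r c = 1 := by
      ext a b
      change (if a.1 = w.1 (w.alpha b.1) then (1 : ℂ) else 0) = _
      rw [apply_alpha, Matrix.one_apply]
      exact if_congr Subtype.ext_iff.symm rfl rfl
    rw [this, Matrix.rank_one, Fintype.card_subtype]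
    rfl

/-- A nonzero minor has independent rows, in particular those of `I` below `h`; these would exceed
the rank bound. -/
theorem minor_eq_zero_of_letterCount_lt (w : FubiniWord n k) {A : Matrix (Fin k) (Fin n) ℂ}
    (hA : A ∈ w.cell) {I : Finset (Fin k)} {J : Finset (Fin n)} (hIJ : I.card = J.card) {h i : ℕ}
    (hlt : w.letterCount h i + (J \ w.firstCols i).card <
      (I.filter fun a : Fin k => (a : ℕ) < h).card) :
    minor A I J hIJ = 0 := by
  by_contra hne
  let f := I.orderEmbOfFin hIJ
  let g := J.orderEmbOfFin rfl
  have hli : LinearIndependent ℂ (A.submatrix f g).row :=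
    Matrix.linearIndependent_rows_of_det_ne_zero hne
  have hli' := hli.comp (Subtype.val : {x // (f x : ℕ) < h} → _) Subtype.val_injective
  have h1 : (A.submatrix (fun x : {x // (f x : ℕ) < h} => f x.1) g).rank =
      Fintype.card {x // (f x : ℕ) < h} := hli'.rank_matrix
  have h2 := w.rank_submatrix_le_letterCount hA (fun x : {x // (f x : ℕ) < h} => f x.1) g
    (fun x => x.2) i
  have h3 : (Finset.univ.filter fun y => g y ∉ w.firstCols i).card =
      (J \ w.firstCols i).card := by
    rw [← Finset.card_map g.toEmbedding]
    congr 1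
    ext j
    simp only [Finset.mem_map, Finset.mem_filter, Finset.mem_univ, true_and, Finset.mem_sdiff]
    constructor
    · rintro ⟨y, hy, rfl⟩
      exact ⟨Finset.orderEmbOfFin_mem _ _ _, hy⟩
    · rintro ⟨hj, hj'⟩
      have : j ∈ Set.range g := by simpa [g] using hj
      obtain ⟨y, rfl⟩ := this
      exact ⟨y, hj', rfl⟩
  have h4 : Fintype.card {x // (f x : ℕ) < h} =
      (I.filter fun a : Fin k => (a : ℕ) < h).card := by
    rw [Fintype.card_subtype, ← Finset.card_map f.toEmbedding]
    congr 1
    ext a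
    simp only [Finset.mem_map, Finset.mem_filter, Finset.mem_univ, true_and]
    constructor
    · rintro ⟨y, hy, rfl⟩
      exact ⟨Finset.orderEmbOfFin_mem _ _ _, hy⟩
    · rintro ⟨hj, hj'⟩
      have : a ∈ Set.range f := by simpa [f] using hj
      obtain ⟨y, rfl⟩ := this
      exact ⟨y, hj', rfl⟩
  omega

/-- Other enumerations of `I` and `J` permute rows and columns separately, which can change the sign
of the determinant but not its invertibility. -/
theorem minor_ne_zero_iff {γ : Type*} [Fintype γ] [DecidableEq γ] (A : Matrix (Fin k) (Fin n) ℂ)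
    {I : Finset (Fin k)} {J : Finset (Fin n)} (hIJ : I.card = J.card) {f : γ → Fin k}
    {g : γ → Fin n} (hf : Function.Injective f) (hg : Function.Injective g)
    (hI : Finset.univ.image f = I) (hJ : Finset.univ.image g = J) :
    minor A I J hIJ ≠ 0 ↔ (A.submatrix f g).det ≠ 0 := by
  have hI' : Set.range f = I := by rw [← hI]; simp
  have hJ' : Set.range g = J := by rw [← hJ]; simp
  let e₁ : Fin J.card ≃ γ := (I.orderIsoOfFin hIJ).toEquiv.trans
    ((Equiv.setCongr hI'.symm).trans (Equiv.ofInjective f hf).symm)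
  let e₂ : Fin J.card ≃ γ := (J.orderIsoOfFin rfl).toEquiv.trans
    ((Equiv.setCongr hJ'.symm).trans (Equiv.ofInjective g hg).symm)
  have h1 : ∀ x, f (e₁ x) = I.orderEmbOfFin hIJ x := fun x => by
    exact Equiv.apply_ofInjective_symm hf _
  have h2 : ∀ x, g (e₂ x) = J.orderEmbOfFin rfl x := fun x => by
    exact Equiv.apply_ofInjective_symm hg _
  have h3 : A.submatrix (I.orderEmbOfFin hIJ) (J.orderEmbOfFin rfl) =
      (A.submatrix f g).submatrix e₁ e₂ := by
    ext x y
    simp [h1, h2]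
  rw [minor, h3, ← isUnit_iff_ne_zero, ← isUnit_iff_ne_zero, ← Matrix.isUnit_iff_isUnit_det,
    ← Matrix.isUnit_iff_isUnit_det, Matrix.isUnit_submatrix_equiv]

end FubiniWord

/-! ### Nonvanishing minors and the vanishing criterion -/

namespace FubiniWord

variable {n k : ℕ}

/-- A matching of rows `κ x` with columns `g x` that is compatible with the pattern of `w`,
together with a way `ι` of pushing these rows down, yields a minor that does not vanish on the
cell of `w`. -/
theorem exists_mem_cell_det_ne_zero (w : FubiniWord n k) {γ : Type*} [Fintype γ] [DecidableEq γ]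
    {κ ι : γ → Fin k} {g : γ → Fin n} (hκ : Function.Injective κ) (hι : Function.Injective ι)
    (hg : Function.Injective g) (hle : ∀ x, κ x ≤ ι x)
    (hidx : ∀ x, w.letterIndex (κ x) ≤ w.letterIndex (w.1 (g x)))
    (hin : ∀ x, g x ∈ w.initialPositions → κ x ≤ w.1 (g x)) :
    ∃ A ∈ w.cell, (A.submatrix ι g).det ≠ 0 := by
  classical
  -- The weights 4 in Y and 2 in X force strict column dominance. A column of Y sums to 1 or 5,
  -- according to whether its matched entry is the forced 1 or a 4. If κ x = ι x, the diagonal entry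
  -- 1 or 4 beats off-diagonal sums at most 0 or 3. Otherwise it is at least 2 or 8, against at most
  -- 1 or 7.
  let z : Fin k → Fin n → ℕ := fun a j =>
    if a = w.1 j then 1 else if ∃ x, g x = j ∧ κ x = a then 4 else 0
  let X : Matrix (Fin k) (Fin k) ℂ := fun b a =>
    if b = a then 1 else if ∃ x, ι x = b ∧ κ x = a then 2 else 0
  let Y : Matrix (Fin k) (Fin n) ℂ := fun a j => (z a j : ℂ)
  have hX : IsLowerUnitriangular X := by
    refine ⟨fun a => by simp [X], fun a b hab => ?_⟩
    have : ¬ ∃ x, ι x = a ∧ κ x = b := by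
      rintro ⟨x, rfl, rfl⟩
      exact absurd hab (not_lt.2 (hle x))
    simp [X, hab.ne, this]
  have hY : w.FitsPattern Y := by
    refine ⟨fun j => by simp [Y, z], fun a j haj hn => ?_⟩
    have : ¬ ∃ x, g x = j ∧ κ x = a := by
      rintro ⟨x, rfl, rfl⟩
      -- A matched position not carrying the forced 1 is free: `hidx` and `hin` become strict
      -- because the two letters differ.
      refine hn ⟨w.alpha_lt_alpha.2 (lt_of_le_of_ne (hidx x) ?_),
        fun h => lt_of_le_of_ne (hin x h) haj⟩
      exact fun h => haj (w.letterIndex.injective h)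
    simp [Y, z, haj, this]
  refine ⟨X * Y, ⟨X, Y, hX, hY, rfl⟩, ?_⟩
  have hentry : ∀ y j, (X * Y) (ι y) j =
      ((z (ι y) j + (if κ y = ι y then 0 else 2 * z (κ y) j) : ℕ) : ℂ) := by
    intro y j
    have hrow : ∀ a, X (ι y) a = if a = ι y then 1 else if a = κ y then 2 else 0 := by
      intro a
      by_cases h1 : a = ι y
      · simp [X, h1]
      · have h2 : (∃ x, ι x = ι y ∧ κ x = a) ↔ a = κ y :=
          ⟨fun ⟨x, hx, hx'⟩ => by rw [← hx', hι hx], fun h => ⟨y, rfl, h.symm⟩⟩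
        simp only [X, h2, if_neg h1, if_neg (Ne.symm h1)]
    have hsplit : ∀ a, X (ι y) a * Y a j = (if a = ι y then (z a j : ℂ) else 0) +
        (if a = κ y then (if κ y = ι y then 0 else 2 * (z a j : ℂ)) else 0) := by
      intro a
      rw [hrow]
      by_cases h1 : a = ι y <;> by_cases h2 : a = κ y
      · have h3 : κ y = ι y := h2.symm.trans h1
        simp [h1, h3, Y]
      · simp only [if_pos h1, if_neg h2, one_mul, add_zero, Y]
      · have h3 : κ y ≠ ι y := fun h => h1 (h2.trans h)
        simp [h2, h3, Y]
      · simp [h1, h2]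
    rw [Matrix.mul_apply, Finset.sum_congr rfl fun a _ => hsplit a, Finset.sum_add_distrib,
      Finset.sum_ite_eq', Finset.sum_ite_eq', if_pos (Finset.mem_univ _),
      if_pos (Finset.mem_univ _)]
    push_cast
    rfl
  refine det_ne_zero_of_sum_col_lt_diag fun x => ?_
  simp only [Matrix.submatrix_apply, hentry, Complex.norm_natCast]
  rw [← Nat.cast_sum, Nat.cast_lt]
  have htot : ∑ a, z a (g x) = 1 + if κ x = w.1 (g x) then 0 else 4 := by
    have : ∀ a, z a (g x) = (if a = w.1 (g x) then 1 else 0) +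
        (if a = κ x then (if κ x = w.1 (g x) then 0 else 4) else 0) := by
      intro a
      have h2 : (∃ y, g y = g x ∧ κ y = a) ↔ a = κ x :=
        ⟨fun ⟨y, hy, hy'⟩ => by rw [← hy', hg hy], fun h => ⟨x, rfl, h.symm⟩⟩
      simp only [z, h2]
      by_cases h3 : a = w.1 (g x) <;> by_cases h4 : a = κ x
      · have h5 : κ x = w.1 (g x) := h4.symm.trans h3
        simp [h3, h5]
      · simp only [if_pos h3, if_neg h4, add_zero]
      · have h5 : κ x ≠ w.1 (g x) := fun h => h3 (h4.trans h)
        simp [h4, h5]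
      · simp [h3, h4]
    rw [Finset.sum_congr rfl fun a _ => this a, Finset.sum_add_distrib,
      Finset.sum_ite_eq', Finset.sum_ite_eq', if_pos (Finset.mem_univ _),
      if_pos (Finset.mem_univ _)]
  -- An injective choice of rows meets each entry of the column at most once, so the column total
  -- bounds both the ι-part and the κ-part.
  have hsum : ∀ f : γ → Fin k, Function.Injective f →
      ∑ y ∈ Finset.univ.erase x, z (f y) (g x) + z (f x) (g x) ≤ ∑ a, z a (g x) := by
    intro f hf
    rw [Finset.sum_erase_add _ _ (Finset.mem_univ x),
      ← Finset.sum_image (f := fun a => z a (g x)) (fun _ _ _ _ h => hf h)]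
    exact Finset.sum_le_sum_of_subset (Finset.subset_univ _)
  have h1 := hsum ι hι
  have h2 := hsum κ hκ
  have h3 : ∑ y ∈ Finset.univ.erase x,
      (z (ι y) (g x) + (if κ y = ι y then 0 else 2 * z (κ y) (g x))) ≤
      ∑ y ∈ Finset.univ.erase x, z (ι y) (g x) +
        2 * ∑ y ∈ Finset.univ.erase x, z (κ y) (g x) := by
    rw [Finset.sum_add_distrib, Finset.mul_sum]
    refine Nat.add_le_add_left (Finset.sum_le_sum fun y _ => ?_) _
    split_ifs <;> omega
  have hzκ : z (κ x) (g x) = if κ x = w.1 (g x) then 1 else 4 := by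
    have : ∃ y, g y = g x ∧ κ y = κ x := ⟨x, rfl, rfl⟩
    simp only [z, this, if_true]
  by_cases hκι : κ x = ι x
  · rw [if_pos hκι]
    rw [← hκι] at h1 ⊢
    split_ifs at htot hzκ <;> omega
  · rw [if_neg hκι]
    split_ifs at htot hzκ <;> omega

/-- The matching is run with the letters as rows. Initial columns are determined by their letters,
so they can serve as the set `S`. The choice of `ι` is left open: the vanishing criterion pushes the
rows to a prescribed `I`, while the comparison of two words leaves them in place. -/
theorem exists_mem_cell_det_ne_zero_of_le_letterCount (w : FubiniWord n k) {γ : Type*}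
    [Fintype γ] [DecidableEq γ] (d : γ → Fin k) (J : Finset (Fin n)) [Nonempty (Fin n)]
    (hc : ∀ (h : Fin k) (i : ℕ), (Finset.univ.filter fun x => d x ≤ h).card ≤
      w.letterCount (h + 1) i + (J \ w.firstCols i).card) :
    ∃ (κ : γ → Fin k) (g : γ → Fin n), Function.Injective κ ∧ Function.Injective g ∧
      (∀ x, g x ∈ J) ∧ (∀ x, κ x ≤ d x) ∧
      ∀ ι : γ → Fin k, Function.Injective ι → (∀ x, κ x ≤ ι x) →
        ∃ A ∈ w.cell, (A.submatrix ι g).det ≠ 0 := by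
  have hS : Set.InjOn w.1 (w.initialPositions : Set (Fin n)) := by
    intro x hx y hy hxy
    rw [Finset.mem_coe, mem_initialPositions] at hx hy
    rw [← hx, hxy, hy]
  obtain ⟨κ, g, hκ, hg, hall⟩ := exists_matching (fun a => (w.letterIndex a : ℕ)) w.1
    (w.initialPositions : Set (Fin n)) hS d Finset.univ (Finset.univ : Finset γ) J
    (fun j _ _ => Finset.mem_univ _) (fun h i => by
      refine (hc h i).trans (le_of_eq ?_)
      rw [letterCount]
      congr 2
      · ext a
        simp only [Finset.mem_filter, Finset.mem_univ, true_and, Fin.le_def, Nat.lt_add_one_iff]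
      · ext j
        simp)
  rw [Finset.coe_univ, Set.injOn_univ] at hκ hg
  have hall' := fun x => hall x (Finset.mem_univ x)
  exact ⟨κ, g, hκ, hg, fun x => (hall' x).2.1, fun x => (hall' x).2.2.1, fun ι hι hle =>
    w.exists_mem_cell_det_ne_zero hκ hι hg hle (fun x => (hall' x).2.2.2.1)
      fun x => (hall' x).2.2.2.2⟩

theorem mem_vanishingMinors_iff (w : FubiniWord n k) {I : Finset (Fin k)} {J : Finset (Fin n)}
    (hIJ : I.card = J.card) :
    (I, J) ∈ w.vanishingMinors ↔ ∃ h i : ℕ, w.letterCount h i + (J \ w.firstCols i).card <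
      (I.filter fun a : Fin k => (a : ℕ) < h).card := by
  classical
  refine ⟨fun hv => ?_, fun ⟨h, i, hlt⟩ =>
    ⟨hIJ, fun A hA => w.minor_eq_zero_of_letterCount_lt hA hIJ hlt⟩⟩
  by_contra! hcon
  obtain ⟨A, hA, hne⟩ : ∃ A ∈ w.cell, minor A I J hIJ ≠ 0 := by
    rcases isEmpty_or_nonempty (Fin n) with hn | hn
    · obtain ⟨A, hA⟩ := w.cell_nonempty
      have hJ : J = ∅ := Finset.eq_empty_of_isEmpty J
      subst hJ
      exact ⟨A, hA, by simp [minor]⟩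
    obtain ⟨κ, g, -, hg, hgJ, hle, hex⟩ :=
      -- Each row of `I` is its own deadline, so the matched row can be pushed down onto it by X.
      w.exists_mem_cell_det_ne_zero_of_le_letterCount (fun x : I => x.1) J (fun h i => by
        refine le_trans (le_of_eq ?_) (hcon (h + 1) i)
        rw [← Finset.card_map (Function.Embedding.subtype _)]
        congr 1
        ext a
        simp only [Finset.mem_map, Finset.mem_filter, Finset.mem_univ, true_and, Fin.le_def,
          Nat.lt_add_one_iff, Function.Embedding.subtype_apply]
        exact ⟨fun ⟨x, hx, e⟩ => e ▸ ⟨x.2, hx⟩, fun ha => ⟨⟨a, ha.1⟩, ha.2, rfl⟩⟩)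
    obtain ⟨A, hA, hdet⟩ := hex (fun x : I => x.1) Subtype.val_injective hle
    refine ⟨A, hA, (minor_ne_zero_iff A hIJ Subtype.val_injective hg (by ext; simp) ?_).2 hdet⟩
    refine Finset.eq_of_subset_of_card_le (Finset.image_subset_iff.2 fun x _ => hgJ x) ?_
    rw [Finset.card_image_of_injective _ hg]
    simp [hIJ]
  exact hne (hv.2 A hA)

end FubiniWord

/-! ### Reduction of rank conditions to essential boxes -/

namespace FubiniWord

variable {n k : ℕ}

theorem letterCount_zero_right (w : FubiniWord n k) (h : ℕ) : w.letterCount h 0 = 0 := by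
  simp [letterCount]

theorem letterCount_of_le_left (w : FubiniWord n k) {h : ℕ} (hh : k ≤ h) (i : ℕ) :
    w.letterCount h i = w.letterCount k i := by
  rw [letterCount, letterCount]
  congr 1
  ext a
  have := a.2
  simp only [Finset.mem_filter, Finset.mem_univ, true_and]
  omega

theorem letterCount_of_le_right (w : FubiniWord n k) {h i : ℕ} (hh : h ≤ k) (hi : k ≤ i) :
    w.letterCount h i = h := by
  have : (Finset.univ.filter fun a : Fin k => (a : ℕ) < h ∧ (w.letterIndex a : ℕ) < i) =
      Finset.univ.filter fun a : Fin k => (a : ℕ) < h := by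
    ext a
    have := (w.letterIndex a).2
    simp only [Finset.mem_filter, Finset.mem_univ, true_and]
    omega
  rw [letterCount, this, Fin.card_filter_val_lt, min_eq_right hh]

theorem firstCols_zero (w : FubiniWord n k) : w.firstCols 0 = ∅ := by
  ext j
  simp

theorem firstCols_of_le (w : FubiniWord n k) {i : ℕ} (hi : k ≤ i) :
    w.firstCols i = Finset.univ := by
  ext j
  simpa using (w.letterIndex (w.1 j)).2.trans_le hi

theorem firstCols_mono (w : FubiniWord n k) {i i' : ℕ} (h : i ≤ i') :
    w.firstCols i ⊆ w.firstCols i' := fun j hj => by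
  rw [mem_firstCols] at hj ⊢
  omega

theorem letterCount_succ_left (w : FubiniWord n k) (a : Fin k) (i : ℕ) :
    w.letterCount (a + 1) i =
      w.letterCount a i + if (w.letterIndex a : ℕ) < i then 1 else 0 := by
  rw [letterCount, letterCount]
  split_ifs with h
  · rw [← Finset.card_insert_of_notMem (a := a) (by simp)]
    congr 1
    ext b
    simp only [Finset.mem_filter, Finset.mem_univ, true_and, Finset.mem_insert]
    constructor
    · rintro ⟨h1, h2⟩
      rcases Nat.lt_succ_iff_lt_or_eq.1 h1 with h3 | h3
      · exact Or.inr ⟨h3, h2⟩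
      · exact Or.inl (Fin.ext h3)
    · rintro (rfl | h1)
      · exact ⟨Nat.lt_succ_self _, h⟩
      · exact ⟨by omega, h1.2⟩
  · rw [add_zero]
    congr 1
    ext b
    simp only [Finset.mem_filter, Finset.mem_univ, true_and]
    constructor
    · rintro ⟨h1, h2⟩
      rcases Nat.lt_succ_iff_lt_or_eq.1 h1 with h3 | h3
      · exact ⟨h3, h2⟩
      · exact absurd (Fin.ext h3 ▸ h2) h
    · rintro ⟨h1, h2⟩
      exact ⟨by omega, h2⟩

theorem letterCount_succ_right (w : FubiniWord n k) (h : ℕ) (i : Fin k) :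
    w.letterCount h (i + 1) =
      w.letterCount h i + if (w.initialPerm i : ℕ) < h then 1 else 0 := by
  have hi : ∀ b, (w.letterIndex b : ℕ) = i → b = w.initialPerm i := fun b hb => by
    rw [← Fin.ext hb, initialPerm_letterIndex]
  rw [letterCount, letterCount]
  split_ifs with hh
  · rw [← Finset.card_insert_of_notMem (a := w.initialPerm i) (by simp)]
    congr 1
    ext b
    simp only [Finset.mem_filter, Finset.mem_univ, true_and, Finset.mem_insert]
    constructor
    · rintro ⟨h1, h2⟩
      rcases Nat.lt_succ_iff_lt_or_eq.1 h2 with h3 | h3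
      · exact Or.inr ⟨h1, h3⟩
      · exact Or.inl (hi b h3)
    · rintro (rfl | h1)
      · exact ⟨hh, by simp⟩
      · exact ⟨h1.1, by omega⟩
  · rw [add_zero]
    congr 1
    ext b
    simp only [Finset.mem_filter, Finset.mem_univ, true_and]
    constructor
    · rintro ⟨h1, h2⟩
      rcases Nat.lt_succ_iff_lt_or_eq.1 h2 with h3 | h3
      · exact ⟨h1, h3⟩
      · exact absurd (hi b h3 ▸ h1) hh
    · rintro ⟨h1, h2⟩
      exact ⟨h1, by omega⟩

theorem letterCount_le_add_sub (w : FubiniWord n k) (m h i : ℕ) :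
    w.letterCount m i ≤ w.letterCount h i + (m - h) := by
  have h1 : (Finset.univ.filter fun a : Fin k => h ≤ (a : ℕ) ∧ (a : ℕ) < m).card ≤ m - h := by
    rw [← Nat.card_Ico, ← Finset.card_map Fin.valEmbedding]
    refine Finset.card_le_card fun a ha => ?_
    simp only [Finset.mem_map, Finset.mem_filter, Finset.mem_univ, true_and] at ha
    obtain ⟨b, hb, rfl⟩ := ha
    exact Finset.mem_Ico.2 hb
  refine le_trans ((Finset.card_le_card fun a ha => ?_).trans (Finset.card_union_le _ _))
    (Nat.add_le_add_left h1 _)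
  simp only [Finset.mem_union, Finset.mem_filter, Finset.mem_univ, true_and] at ha ⊢
  omega

/-- The number of occurrences of the letter `a`. -/
def multiplicity (w : FubiniWord n k) (a : Fin k) : ℕ :=
  (Finset.univ.filter fun j => w.1 j = a).card

theorem card_sdiff_firstCols_le (w : FubiniWord n k) (B : Finset (Fin n)) (i : Fin k) :
    (B \ w.firstCols i).card ≤
      (B \ w.firstCols (i + 1)).card + w.multiplicity (w.initialPerm i) := by
  classical
  rw [multiplicity]
  refine (Finset.card_le_card fun j hj => ?_).trans (Finset.card_union_le _ _)
  simp only [Finset.mem_union, Finset.mem_sdiff, mem_firstCols, Finset.mem_filter,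
    Finset.mem_univ, true_and] at hj ⊢
  by_cases h : (w.letterIndex (w.1 j) : ℕ) < i + 1
  · right
    have : w.letterIndex (w.1 j) = i := Fin.ext (by omega)
    rw [← this, initialPerm_letterIndex]
  · exact Or.inl ⟨hj.1, h⟩

/-- A combinatorial description of the boxes `(h, |β_i|)` of the essential set. -/
structure IsEssentialBox (w : FubiniWord n k) (h : ℕ) (i : Fin k) : Prop where
  pos : 0 < h
  le : h ≤ k
  next_lt : ∃ hi : (i : ℕ) + 1 < k, (w.initialPerm ⟨i + 1, hi⟩ : ℕ) < h
  ge_or : h ≤ (w.initialPerm i : ℕ) ∨ 2 ≤ w.multiplicity (w.initialPerm i)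
  row : ∀ a : Fin k, (a : ℕ) + 1 = h → i < w.letterIndex a
  row_next : ∀ a : Fin k, (a : ℕ) = h → w.letterIndex a ≤ i

/-- Every rank condition is trivial or implied by the one of an essential box. -/
theorem exists_isEssentialBox (w : FubiniWord n k) {m : ℕ} (hm : m ≤ k) (B : Finset (Fin n))
    {c : ℕ} (N : ℕ) : ∀ h i : ℕ, h ≤ k → i ≤ k →
      w.letterCount h i * (2 * k + 1) + (2 * k - (h + i)) ≤ N →
      w.letterCount h i + (m - h) + (B \ w.firstCols i).card ≤ c →
      m ≤ c ∨ B.card ≤ c ∨ ∃ (h : ℕ) (i : Fin k), w.IsEssentialBox h i ∧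
        w.letterCount h (i + 1) + (m - h) + (B \ w.firstCols (i + 1)).card ≤ c := by
  -- Each move either keeps the letter count and increases h + i, or lowers the count by one; the
  -- factor 2k + 1 makes the count dominate the term 2k - (h + i), so the potential always drops.
  induction N using Nat.strong_induction_on with
  | _ N ih =>
    intro h i hh hi hN hc
    rcases Nat.eq_zero_or_pos h with rfl | hpos
    · left
      omega
    rcases hi.eq_or_lt with rfl | hik
    · rw [w.letterCount_of_le_right hh le_rfl] at hc
      left
      omega
    rcases Nat.eq_zero_or_pos i with rfl | hipos
    · rw [firstCols_zero, Finset.sdiff_empty] at hc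
      right
      left
      omega
    -- If the next letter is not below `h`, including it is free.
    by_cases e1 : (w.initialPerm ⟨i, hik⟩ : ℕ) < h
    swap
    · have h1 := w.letterCount_succ_right h ⟨i, hik⟩
      rw [if_neg e1, add_zero] at h1
      simp only at h1
      have h2 : (B \ w.firstCols (i + 1)).card ≤ (B \ w.firstCols i).card :=
        Finset.card_le_card (Finset.sdiff_subset_sdiff le_rfl (w.firstCols_mono (by omega)))
      refine ih _ ?_ h (i + 1) hh hik le_rfl (by omega)
      rw [h1]
      omega
    obtain ⟨i, rfl⟩ : ∃ i', i = i' + 1 := ⟨i - 1, by omega⟩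
    have hik' : i < k := by omega
    -- If the last letter is below `h` and occurs once, removing it lowers the count by one and
    -- loses at most one column.
    by_cases e2 : h ≤ (w.initialPerm ⟨i, hik'⟩ : ℕ) ∨
        2 ≤ w.multiplicity (w.initialPerm ⟨i, hik'⟩)
    swap
    · push Not at e2
      have h1 := w.letterCount_succ_right h ⟨i, hik'⟩
      rw [if_pos e2.1] at h1
      have h2 := w.card_sdiff_firstCols_le B ⟨i, hik'⟩
      simp only at h1 h2
      refine ih _ ?_ h i hh (by omega) le_rfl (by omega)
      rw [h1, Nat.add_mul] at hN
      omega
    have hh1 : h - 1 < k := by omega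
    have hh1' : h - 1 + 1 = h := by omega
    -- If row `h - 1` is counted, removing it lowers the count by one, which pays for the growth of
    -- `m - h`.
    by_cases e3 : i < (w.letterIndex ⟨h - 1, hh1⟩ : ℕ)
    swap
    · have h1 := w.letterCount_succ_left ⟨h - 1, hh1⟩ (i + 1)
      rw [if_pos (by omega)] at h1
      simp only [hh1'] at h1
      refine ih _ ?_ (h - 1) (i + 1) (by omega) hi le_rfl (by omega)
      rw [h1, Nat.add_mul] at hN
      omega
    -- If row `h` would not be counted, adding it is free. When none of the four moves applies, the
    -- box is essential.
    by_cases e4 : ∃ hk : h < k, i < (w.letterIndex ⟨h, hk⟩ : ℕ)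
    · obtain ⟨hk, e4⟩ := e4
      have h1 := w.letterCount_succ_left ⟨h, hk⟩ (i + 1)
      rw [if_neg (by omega), add_zero] at h1
      simp only at h1
      refine ih _ ?_ (h + 1) (i + 1) (by omega) hi le_rfl (by omega)
      rw [h1]
      omega
    push Not at e4
    refine Or.inr (Or.inr ⟨h, ⟨i, hik'⟩, ⟨hpos, hh, ⟨hik, e1⟩, e2, ?_, ?_⟩, hc⟩)
    · rintro a ha
      have : a = ⟨h - 1, hh1⟩ := Fin.ext (by simp only; omega)
      rw [this]
      exact e3
    · rintro a rfl
      exact e4 a.2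

/-! ### The essential set of the standardized convexification -/

theorem letterIndex_conv (w : FubiniWord n k) : w.conv.letterIndex = w.letterIndex := by
  refine Equiv.ext fun a => w.initialPerm_injective ?_
  rw [initialPerm_letterIndex, ← conv_initialPerm, initialPerm_letterIndex]

theorem multiplicity_conv (w : FubiniWord n k) (a : Fin k) :
    w.conv.multiplicity a = w.multiplicity a := w.conv_content a

theorem letterIndex_conv_monotone (w : FubiniWord n k) :
    Monotone fun j => w.conv.letterIndex (w.conv.1 j) := fun i j hij => by
  rw [letterIndex_conv, ← alpha_le_alpha]
  exact w.alpha_conv_monotone hij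

theorem card_firstCols_conv (w : FubiniWord n k) (i : ℕ) :
    (w.conv.firstCols i).card = (w.firstCols i).card :=
  Finset.card_equiv (Tuple.sort fun i => w.alpha (w.1 i)) (fun j => by
    rw [mem_firstCols, mem_firstCols, letterIndex_conv]
    rfl)

/-- Convexification sorts the letters by index, so the first `i` letters fill an initial interval of
positions. -/
theorem mem_firstCols_conv (w : FubiniWord n k) (i : ℕ) (j : Fin n) :
    j ∈ w.conv.firstCols i ↔ (j : ℕ) < (w.firstCols i).card := by
  rw [← card_firstCols_conv]
  constructor
  · intro hj
    have : Finset.Iic j ⊆ w.conv.firstCols i := fun l hl => by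
      rw [mem_firstCols] at hj ⊢
      exact lt_of_le_of_lt (Fin.le_def.1 (w.letterIndex_conv_monotone (Finset.mem_Iic.1 hl))) hj
    have := Finset.card_le_card this
    rw [Fin.card_Iic] at this
    omega
  · intro hj
    by_contra hn
    have : w.conv.firstCols i ⊆ Finset.Iio j := fun l hl => by
      rw [Finset.mem_Iio]
      by_contra hlj
      rw [mem_firstCols] at hl hn
      exact hn (lt_of_le_of_lt (Fin.le_def.1 (w.letterIndex_conv_monotone (not_lt.1 hlj))) hl)
    have := Finset.card_le_card this
    rw [Fin.card_Iio] at this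
    omega

theorem std_of_mem (w : FubiniWord n k) {j : Fin n} (hj : j ∈ w.initialPositions) :
    (w.std j : ℕ) = w.1 j := by
  simp [std, stdFun, hj]

theorem std_of_notMem (w : FubiniWord n k) {j : Fin n} (hj : j ∉ w.initialPositions) :
    (w.std j : ℕ) = k + w.redundantBefore j := by
  simp [std, stdFun, hj]

/-- Redundant positions get values at least `k`, increasing from left to right, so everything to
their left is smaller. -/
theorem mem_initialPositions_of_inversion (w : FubiniWord n k) {x y : Fin n} (hxy : x < y)
    (h : w.std y < w.std x) : y ∈ w.initialPositions := by
  by_contra hy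
  rw [Fin.lt_def, w.std_of_notMem hy] at h
  by_cases hx : x ∈ w.initialPositions
  · rw [w.std_of_mem hx] at h
    have := (w.1 x).2
    omega
  · rw [w.std_of_notMem hx] at h
    have := w.redundantBefore_lt hx hxy
    omega

/-- These strict bounds rule out the trivial outcomes of `exists_isEssentialBox`. For the inversion
(x, y) behind the box, y is initial with letter `m - 1` and lies outside the first columns, so that
letter is below `m` but uncounted. The column x lies inside them but is not the initial position of
a counted letter. -/
theorem le_and_letterCount_lt_of_mem_essentialSet (w : FubiniWord n k) {m : ℕ} {i : Fin k}
    (h : (m, (w.beta i).card) ∈ essentialSet w.conv.std) :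
    0 < m ∧ m ≤ k ∧ w.letterCount m (i + 1) < m ∧
      w.letterCount m (i + 1) < (w.beta i).card := by
  obtain ⟨⟨x, y, hxy, hσ, he⟩, -, -⟩ := h
  rw [beta_eq] at he ⊢
  obtain ⟨h1, h2⟩ := Prod.mk.inj he
  have hy := w.conv.mem_initialPositions_of_inversion hxy hσ
  have hσy := w.conv.std_of_mem hy
  have hmk : m ≤ k := by
    have := (w.conv.1 y).2
    omega
  have hyn : y ∉ w.conv.firstCols (i + 1) := by
    rw [mem_firstCols_conv]
    have := Fin.lt_def.1 hxy
    omega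
  rw [mem_firstCols, letterIndex_conv] at hyn
  refine ⟨by omega, hmk, ?_, ?_⟩
  · have h3 := w.letterCount_of_le_right hmk le_rfl
    conv_rhs => rw [← h3]
    refine Finset.card_lt_card (Finset.ssubset_iff_of_subset (fun a ha => ?_) |>.2
      ⟨w.conv.1 y, ?_, ?_⟩)
    · simp only [Finset.mem_filter, Finset.mem_univ, true_and] at ha ⊢
      exact ⟨ha.1, (w.letterIndex a).2⟩
    · simp only [Finset.mem_filter, Finset.mem_univ, true_and]
      exact ⟨by omega, (w.letterIndex _).2⟩
    · simp only [Finset.mem_filter, Finset.mem_univ, true_and]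
      exact fun h => hyn h.2
  · rw [← card_firstCols_conv, letterCount,
      ← Finset.card_image_of_injective _ w.conv.alpha_injective]
    refine Finset.card_lt_card (Finset.ssubset_iff_of_subset
      (Finset.image_subset_iff.2 fun a ha => ?_) |>.2 ⟨x, ?_, fun hx => ?_⟩)
    · rw [mem_firstCols, apply_alpha, letterIndex_conv]
      exact (Finset.mem_filter.1 ha).2.2
    · rw [mem_firstCols_conv]
      omega
    · obtain ⟨a, ha, rfl⟩ := Finset.mem_image.1 hx
      have h4 := w.conv.std_of_mem (Finset.mem_image_of_mem _ (Finset.mem_univ a) :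
        w.conv.alpha a ∈ w.conv.initialPositions)
      rw [apply_alpha] at h4
      have := (Finset.mem_filter.1 ha).2.1
      have := Fin.lt_def.1 hσ
      omega

/-- Each field controls one side of the box in the diagram of the standardized convexification. Only
this implication is needed, since actual members of the essential set enter solely through their
strict rank bounds. -/
theorem IsEssentialBox.mem_essentialSet {w : FubiniWord n k} {h : ℕ} {i : Fin k}
    (H : w.IsEssentialBox h i) : (h, (w.beta i).card) ∈ essentialSet w.conv.std := by
  obtain ⟨hi1, hnext⟩ := H.next_lt
  have hmem := w.mem_firstCols_conv (i + 1)
  have hidx := w.letterIndex_conv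
  rw [beta_eq]
  set b := (w.firstCols (i + 1)).card with hb
  have halpha : ∀ a, w.conv.1 (w.conv.alpha a) = a := w.conv.apply_alpha
  have hin : ∀ a, w.conv.alpha a ∈ w.conv.initialPositions := fun a =>
    Finset.mem_image_of_mem _ (Finset.mem_univ a)
  have hαi : (w.conv.alpha (w.initialPerm i) : ℕ) < b := by
    rw [← hmem, mem_firstCols, halpha, hidx, letterIndex_initialPerm]
    omega
  have hαi1 : b ≤ (w.conv.alpha (w.initialPerm ⟨i + 1, hi1⟩) : ℕ) := by
    rw [← not_lt, ← hmem, mem_firstCols, halpha, hidx, letterIndex_initialPerm]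
    simp
  have hbn : b < n := lt_of_le_of_lt hαi1 (Fin.is_lt _)
  -- The last column of the block of the letter `initialPerm i`. Its standardized value is at least
  -- `h`: either it is initial and the letter itself is that large, or it is redundant.
  let x : Fin n := ⟨b - 1, by omega⟩
  have hxb : (x : ℕ) + 1 = b := by simp only [x]; omega
  have hxi : w.conv.1 x = w.initialPerm i := by
    have h1 : w.conv.alpha (w.initialPerm i) ≤ x := Fin.le_def.2 (by omega)
    have h2 := w.letterIndex_conv_monotone h1
    simp only [halpha, hidx, letterIndex_initialPerm] at h2
    have h3 := (hmem x).2 (by omega)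
    rw [mem_firstCols, hidx] at h3
    rw [← w.initialPerm_letterIndex (w.conv.1 x)]
    congr 1
    exact le_antisymm (Fin.le_def.2 (by omega)) h2
  have hσx : h ≤ (w.conv.std x : ℕ) := by
    by_cases hx : x ∈ w.conv.initialPositions
    · have hle : h ≤ (w.initialPerm i : ℕ) := by
        refine H.ge_or.resolve_right fun h2 => ?_
        rw [← multiplicity_conv] at h2
        obtain ⟨z, hz, hzx⟩ := Finset.exists_mem_ne h2 x
        rw [Finset.mem_filter] at hz
        have h3 := w.conv.alpha_le z
        rw [hz.2, ← hxi, w.conv.mem_initialPositions.1 hx] at h3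
        have h4 : (z : ℕ) < b := by
          rw [← hmem, mem_firstCols, hz.2, hidx, letterIndex_initialPerm]
          omega
        exact hzx (Fin.ext (by have := Fin.le_def.1 h3; omega))
      rwa [w.conv.std_of_mem hx, hxi]
    · rw [w.conv.std_of_notMem hx]
      have := H.le
      omega
  have hpos := H.pos
  have hle := H.le
  have hh1 : h - 1 < k := by omega
  refine ⟨⟨x, w.conv.alpha ⟨h - 1, hh1⟩, ?_, ?_, ?_⟩, ?_, ?_⟩
  · have h1 := H.row ⟨h - 1, hh1⟩ (by simp only; omega)
    have h2 : ¬ (w.conv.alpha ⟨h - 1, hh1⟩ : ℕ) < b := by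
      rw [← hmem, mem_firstCols, halpha, hidx]
      have := Fin.lt_def.1 h1
      omega
    exact Fin.lt_def.2 (by omega)
  · rw [Fin.lt_def, w.conv.std_of_mem (hin _), halpha]
    simp only
    omega
  · rw [w.conv.std_of_mem (hin _), halpha, hxb]
    simp only [Prod.mk.injEq, and_true]
    omega
  -- A box one row lower would need the letter `h` to start to the right of `x`, contrary to
  -- `row_next`.
  · rintro ⟨x', y', hxy, hσ, he⟩
    obtain ⟨h1, h2⟩ := Prod.mk.inj he
    have hx' : x' = x := Fin.ext (by omega)
    subst hx'
    have hy' := w.conv.mem_initialPositions_of_inversion hxy hσ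
    have h3 := w.conv.std_of_mem hy'
    have h4 := (w.conv.1 y').2
    have h5 := H.row_next (w.conv.1 y') (by omega)
    have h6 : (y' : ℕ) < b := by
      rw [← hmem, mem_firstCols, hidx]
      have := Fin.le_def.1 h5
      omega
    have := Fin.lt_def.1 hxy
    omega
  -- The next column is the initial position of the next letter, whose value is below `h`, so it has
  -- no inversion with the value `h - 1`.
  · rintro ⟨x', y', hxy, hσ, he⟩
    obtain ⟨h1, h2⟩ := Prod.mk.inj he
    have hx'b : (x' : ℕ) = b := by omega
    have h3 : w.conv.1 x' = w.initialPerm ⟨i + 1, hi1⟩ := by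
      have h4 : x' ≤ w.conv.alpha (w.initialPerm ⟨i + 1, hi1⟩) := Fin.le_def.2 (by omega)
      have h5 := Fin.le_def.1 (w.letterIndex_conv_monotone h4)
      simp only [halpha, hidx, letterIndex_initialPerm] at h5
      have h6 : ¬ (x' : ℕ) < b := by omega
      rw [← hmem, mem_firstCols, hidx] at h6
      rw [← w.initialPerm_letterIndex (w.conv.1 x')]
      congr 1
      exact Fin.ext (by simp only; omega)
    have h4 : x' ∈ w.conv.initialPositions := by
      have h5 := w.conv.alpha_le x'
      rw [h3] at h5
      rw [mem_initialPositions, h3]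
      exact le_antisymm h5 (Fin.le_def.2 (by omega))
    have h5 := w.conv.std_of_mem h4
    rw [h3] at h5
    have := Fin.lt_def.1 hσ
    omega

end FubiniWord

/-! ### Comparing two words through their rank functions -/

namespace FubiniWord

variable {n k : ℕ}

/-- The inequality that makes a minor vanish on C_v at (m, j) passes to w at (m, i), because J \
F_w(i) is covered by J \ F_v(j) and F_v(j) \ F_w(i). -/
theorem mediumRoastLE_of_letterCount_le {v w : FubiniWord n k}
    (H : ∀ m j : ℕ, ∃ i : ℕ, w.letterCount m i + (v.firstCols j \ w.firstCols i).card ≤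
      v.letterCount m j) : v.MediumRoastLE w := by
  rintro ⟨I, J⟩ hIJ
  have hcard : I.card = J.card := hIJ.1
  rw [mem_vanishingMinors_iff _ hcard] at hIJ ⊢
  obtain ⟨m, j, hlt⟩ := hIJ
  obtain ⟨i, hi⟩ := H m j
  refine ⟨m, i, lt_of_le_of_lt ?_ hlt⟩
  have h1 : (J \ w.firstCols i).card ≤
      (J \ v.firstCols j).card + (v.firstCols j \ w.firstCols i).card := by
    refine (Finset.card_le_card fun x hx => ?_).trans (Finset.card_union_le _ _)
    simp only [Finset.mem_union, Finset.mem_sdiff] at hx ⊢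
    tauto
  omega

theorem MediumRoastLE.exists_letterCount_le {v w : FubiniWord n k} (H : v.MediumRoastLE w)
    {m : ℕ} (hm : 0 < m) (hmk : m ≤ k) (j : ℕ) :
    ∃ i : ℕ, w.letterCount m i + (v.firstCols j \ w.firstCols i).card ≤ v.letterCount m j := by
  classical
  by_contra! hcon
  have hk : m - 1 < k := by omega
  have : Nonempty (Fin n) := ⟨w.alpha ⟨m - 1, hk⟩⟩
  -- If every i fails, one row more than the rank of v can be matched within the top `m` rows and
  -- the columns F_v(j). The resulting minor vanishes on C_v for rank reasons but not on C_w.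
  obtain ⟨κ, g, hκ, hg, hgJ, hle, hex⟩ := w.exists_mem_cell_det_ne_zero_of_le_letterCount
    (fun _ : Fin (v.letterCount m j + 1) => ⟨m - 1, hk⟩) (v.firstCols j) (fun h i => by
      by_cases hh : (⟨m - 1, hk⟩ : Fin k) ≤ h
      · simp only [hh, Finset.filter_true, Finset.card_univ, Fintype.card_fin]
        have h1 : w.letterCount m i ≤ w.letterCount (h + 1) i :=
          Finset.card_le_card fun a ha => by
            simp only [Finset.mem_filter, Finset.mem_univ, true_and, Fin.le_def] at ha hh ⊢
            omega
        have := hcon i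
        omega
      · simp [hh])
  obtain ⟨A, hA, hdet⟩ := hex κ hκ fun _ => le_rfl
  have hcard : (Finset.univ.image κ).card = (Finset.univ.image g).card := by
    rw [Finset.card_image_of_injective _ hκ, Finset.card_image_of_injective _ hg]
  have hv : (Finset.univ.image κ, Finset.univ.image g) ∈ v.vanishingMinors := by
    rw [mem_vanishingMinors_iff _ hcard]
    refine ⟨m, j, ?_⟩
    rw [Finset.sdiff_eq_empty_iff_subset.2 (Finset.image_subset_iff.2 fun x _ => hgJ x),
      Finset.filter_true_of_mem, Finset.card_image_of_injective _ hκ]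
    · simp
    · intro a ha
      obtain ⟨x, -, rfl⟩ := Finset.mem_image.1 ha
      have := Fin.le_def.1 (hle x)
      simp only at this
      omega
  exact (minor_ne_zero_iff A hcard hκ hg rfl rfl).2 hdet ((H hv).2 A hA)

end FubiniWord

theorem mainTheorem6 {n k : ℕ} (hk : 1 ≤ k) (hkn : k ≤ n) (v w : FubiniWord n k) :
    v.MediumRoastLE w ↔
      ∀ (m : ℕ) (B : Finset (Fin n)) (s : ℕ), (m, B, s) ∈ v.rankedEssentialSet →
        ∃ (h : ℕ) (B' : Finset (Fin n)) (r : ℕ), (h, B', r) ∈ w.rankedEssentialSet ∧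
          max 0 ((m : ℤ) - (h : ℤ)) + ((B \ B').card : ℤ) ≤ (s : ℤ) - (r : ℤ) := by
  constructor
  · rintro H m B s ⟨m', j, hess, he⟩
    obtain ⟨rfl, rfl, rfl⟩ : m = m' ∧ B = v.beta j ∧ s = v.rankFun m' j := by simpa using he
    obtain ⟨hpos, hmk, hlt1, hlt2⟩ := v.le_and_letterCount_lt_of_mem_essentialSet hess
    rw [FubiniWord.rankFun_eq_letterCount]
    obtain ⟨i, hik, hi⟩ : ∃ i ≤ k, w.letterCount m i + (v.beta j \ w.firstCols i).card ≤
        v.letterCount m (j + 1) := by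
      obtain ⟨i, hi⟩ := H.exists_letterCount_le hpos hmk (j + 1)
      rw [← FubiniWord.beta_eq] at hi
      -- For `i ≥ k` the count would be `m`, which exceeds the rank at an essential box of v.
      rcases le_total i k with h | h
      · exact ⟨i, h, hi⟩
      · rw [w.letterCount_of_le_right hmk h] at hi
        omega
    rcases w.exists_isEssentialBox hmk (v.beta j) (c := v.letterCount m (j + 1)) _ m i hmk
      hik le_rfl (by rwa [Nat.sub_self, add_zero]) with h | h | ⟨h, i', hbox, hle⟩
    · omega
    · omega
    · refine ⟨h, w.beta i', _, ⟨h, i', hbox.mem_essentialSet, rfl⟩, ?_⟩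
      rw [FubiniWord.rankFun_eq_letterCount, FubiniWord.beta_eq w]
      omega
  · intro H
    refine FubiniWord.mediumRoastLE_of_letterCount_le fun m j => ?_
    have key : ∀ m ≤ k, ∃ i : ℕ, w.letterCount m i + (v.firstCols j \ w.firstCols i).card ≤
        v.letterCount m j := by
      intro m hm
      have hfull : m ≤ v.letterCount m j → ∃ i : ℕ,
          w.letterCount m i + (v.firstCols j \ w.firstCols i).card ≤ v.letterCount m j := by
        intro hc
        refine ⟨k, ?_⟩
        rw [w.letterCount_of_le_right hm le_rfl, w.firstCols_of_le le_rfl,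
          Finset.sdiff_eq_empty_iff_subset.2 (Finset.subset_univ _), Finset.card_empty]
        omega
      rcases le_total k j with hj | hj
      · exact hfull (v.letterCount_of_le_right hm hj).ge
      rcases v.exists_isEssentialBox hm (v.firstCols j) (c := v.letterCount m j) _ m j hm hj
        le_rfl (by simp) with
        h | h | ⟨h, j', hbox, hle⟩
      · exact hfull h
      · refine ⟨0, ?_⟩
        rw [w.letterCount_zero_right, w.firstCols_zero, Finset.sdiff_empty]
        omega
      -- Only the form of the triple for w matters here, not its essentiality: its index `i` serves
      -- as the witness for (m, j).
      · obtain ⟨h', B', r, ⟨h'', i, -, he⟩, hineq⟩ :=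
          H h (v.beta j') _ ⟨h, j', hbox.mem_essentialSet, rfl⟩
        obtain ⟨rfl, rfl, rfl⟩ : h' = h'' ∧ B' = w.beta i ∧ r = w.rankFun h'' i := by
          simpa using he
        rw [FubiniWord.rankFun_eq_letterCount, FubiniWord.rankFun_eq_letterCount,
          FubiniWord.beta_eq, FubiniWord.beta_eq] at hineq
        refine ⟨i + 1, ?_⟩
        have h1 := w.letterCount_le_add_sub m h' (i + 1)
        have h2 : (v.firstCols j \ w.firstCols (i + 1)).card ≤
            (v.firstCols j \ v.firstCols (j' + 1)).card +
              (v.firstCols (j' + 1) \ w.firstCols (i + 1)).card := by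
          refine (Finset.card_le_card fun x hx => ?_).trans (Finset.card_union_le _ _)
          simp only [Finset.mem_union, Finset.mem_sdiff] at hx ⊢
          tauto
        omega
    -- There are only `k` rows, so larger `m` gives the same condition as `m = k`.
    rcases le_total m k with hm | hm
    · exact key m hm
    · rw [v.letterCount_of_le_left hm]
      simp_rw [w.letterCount_of_le_left hm]
      exact key k le_rfl
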